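/- For $v\ge 0$ let $\mathrm{PG}(v-1,2)$ be the projective space of $\mathbb{F}_2^v$; its points, lines and hyperplanes are the subspaces of $\mathbb{F}_2^v$ of dimension $1$, $2$ and $v-1$, respectively (all dimensions are vector space dimensions). A vector space partition $\mathcal{P}$ of $\mathrm{PG}(v-1,2)$ is a set of nonzero subspaces of $\mathbb{F}_2^v$ such that every point is contained in exactly one element of $\mathcal{P}$. It has type $3^{m_3}2^{m_2}1^{m_1}$ if it has exactly $m_i$ elements of dimension $i$ for $i=1,2,3$ and no others. It has a supertail of type $2^41^5$ if it contains exactly $4$ elements of dimension $2$, exactly $5$ elements of dimension $1$, and at least one element of dimension greater than $2$. A set $\mathcal{S}$ of points is called $4$-divisible if for each hyperplane $H$ the number of points of $\mathcal{S}$ not contained in $H$ is divisible by $4$. Then the following hold. (i) For every $v$, no vector space partition of $\mathrm{PG}(v-1,2)$ has a supertail of type $2^41^5$. (ii) For every $v$ and every $4$-divisible set $\mathcal{S}$ of $17$ points in $\mathrm{PG}(v-1,2)$, there are at most three pairwise disjoint lines all of whose points belong to $\mathcal{S}$. (iii) There is no vector space partition of $\mathrm{PG}(7,2)$ of type $3^{34}2^41^5$.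 -/

import Mathlib

open scoped LinearAlgebra.Projectivization

/-- A set of subspaces of the projective space of `V` is a vector space partition if its
elements are non-empty as sets of points (i.e. nonzero subspaces) and every point lies in
exactly one of them. -/
structure IsVectorSpacePartition {K V : Type*} [Field K] [AddCommGroup V] [Module K V]
    (P : Set (Submodule K V)) : Prop where
  bot_notMem : ⊥ ∉ P
  existsUnique_mem : ∀ p : ℙ K V, ∃! U, U ∈ P ∧ p.submodule ≤ U

/-- `P` has type `⋯ 3^{m 3} 2^{m 2} 1^{m 1}`: exactly `m i` elements of `P` have
(vector space) dimension `i`. -/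
def HasPartitionType {K V : Type*} [Field K] [AddCommGroup V] [Module K V]
    (P : Set (Submodule K V)) (m : ℕ → ℕ) : Prop :=
  ∀ i, {U ∈ P | Module.finrank K U = i}.encard = m i

/-- `P` has an `s`-supertail of type `(a 0)^{m 0} (a 1)^{m 1} ⋯`, where
`a 0 > a 1 > ⋯ ≥ 1` (there are `s ≥ 1` entries, and `m j = 0` is allowed). -/
structure HasSupertail {K V : Type*} [Field K] [AddCommGroup V] [Module K V]
    (P : Set (Submodule K V)) {s : ℕ} [NeZero s] (a m : Fin s → ℕ) : Prop where
  strictAnti : StrictAnti a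
  one_le : ∀ j, 1 ≤ a j
  encard_eq : ∀ j, {U ∈ P | Module.finrank K U = a j}.encard = m j
  exists_lt : ∃ A ∈ P, a 0 < Module.finrank K A
  dim_mem : ∀ B ∈ P, Module.finrank K B ≤ a 0 → ∃ j, Module.finrank K B = a j

/-- A set `S` of points is `Δ`-divisible if, for every hyperplane `H`, the number of points of
`S` not contained in `H` is divisible by `Δ`. -/
def IsDivisiblePointSet {K V : Type*} [Field K] [AddCommGroup V] [Module K V]
    (Δ : ℕ) (S : Set (ℙ K V)) : Prop :=
  ∀ H : Submodule K V, Module.finrank K H + 1 = Module.finrank K V →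
    Δ ∣ {p ∈ S | ¬ p.submodule ≤ H}.ncard

/-!
All three assertions come down to the second one, that a 4-divisible set `S` of 17 points over
`𝔽₂` does not contain four pairwise disjoint lines.

For a linear form `h` let `T h = ∑ (-1) ^ (h ⬝ x)`, the sum over the points `x` of `S`. This is
`17 - 2 w` with `w` the number of points of `S` outside the hyperplane of `h`, so `T h ≡ 1 (mod 8)`.
Suppose that `S` contains four disjoint lines and let `Q` be the set of the five other points, with
character sum `t h`.

* A line contributes `3` or `-1` to `T h`. Hence `t h` is `5`, `1` or `-3`, and the parity of the
  number of lines on which `h` does not vanish is determined by `t h`; as a polynomial identity this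
  is `prod_sum_binaryChar_lines`. Averaging it over all `h` and expanding the product of the four
  line sums (Poisson summation, `sum_prod_sum_binaryChar`) yields `∑ ± 1 = -4`, where the sum is
  over the linear dependencies `y` between points of the four lines, the sign being the parity of the
  number of zero entries of `y`. The zero dependency has sign `+1`, so there are at least six
  dependencies, and at least eight since they form an `𝔽₂`-space
  (`eight_le_card_lineDependencies`). Equivalently, the lines span a space of dimension at most
  five.
* A form that vanishes on the four lines vanishes on all of `S` (`sum_binaryChar_eq_five`), so that
  at least a `1/32` of all forms vanish on `S` (`card_annihilator_lines`).
* The average of `(T - 1) (T + 7)` over all forms is `10`, by the first two moments of `T`. No value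
  is negative because `T ≡ 1 (mod 8)`, and a form vanishing on `S` has the value `384 > 32 * 10`.
  This is the contradiction in `false_of_four_lines`.

For a vector space partition with a supertail of type `2^4 1^5`, the subspaces of dimension at least
three, and the whole space, are 4-divisible. So the points in the supertail form a 4-divisible set
(`IsVectorSpacePartition.isDivisiblePointSet_tailPoints`); there are `4 * 3 + 5 = 17` of them, and
they contain four disjoint lines.
-/

/-! ### Characters of a binary vector space -/

section Characters

theorem add_eq_zero_iff_eq_of_zmodTwo {V : Type*} [AddCommGroup V] [Module (ZMod 2) V] (x y : V) :
    x + y = 0 ↔ x = y := by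
  rw [← sub_eq_zero (a := x), sub_eq_add_neg, ZModModule.neg_eq_self]

variable {ι : Type*} [Fintype ι]

/-- The character `(-1) ^ (h ⬝ x)` of `𝔽₂^ι`, with values in `ℤ`. -/
def binaryChar (h x : ι → ZMod 2) : ℤ := if h ⬝ᵥ x = 0 then 1 else -1

theorem binaryChar_eq_one_iff {h x : ι → ZMod 2} : binaryChar h x = 1 ↔ h ⬝ᵥ x = 0 := by
  unfold binaryChar; split_ifs with hx <;> simp [hx]

theorem binaryChar_eq_one_or (h x : ι → ZMod 2) : binaryChar h x = 1 ∨ binaryChar h x = -1 := by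
  unfold binaryChar; split_ifs <;> simp

theorem binaryChar_comm (h x : ι → ZMod 2) : binaryChar h x = binaryChar x h := by
  rw [binaryChar, binaryChar, dotProduct_comm]

theorem binaryChar_zero_right (h : ι → ZMod 2) : binaryChar h 0 = 1 := by
  simp [binaryChar]

theorem binaryChar_add_right (h x y : ι → ZMod 2) :
    binaryChar h (x + y) = binaryChar h x * binaryChar h y := by
  simp only [binaryChar, dotProduct_add]
  generalize h ⬝ᵥ x = a
  generalize h ⬝ᵥ y = b
  revert a b
  decide

theorem binaryChar_add_left (h k x : ι → ZMod 2) :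
    binaryChar (h + k) x = binaryChar h x * binaryChar k x := by
  simp only [binaryChar_comm _ x, binaryChar_add_right]

theorem binaryChar_sum_right {κ : Type*} (s : Finset κ) (h : ι → ZMod 2) (f : κ → ι → ZMod 2) :
    binaryChar h (∑ i ∈ s, f i) = ∏ i ∈ s, binaryChar h (f i) := by
  classical
  induction s using Finset.induction_on with
  | empty => simp [binaryChar_zero_right]
  | insert a s ha ih => rw [Finset.sum_insert ha, Finset.prod_insert ha, binaryChar_add_right, ih]

theorem sum_binaryChar_eq_card_sub (A : Finset (ι → ZMod 2)) (h : ι → ZMod 2) :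
    ∑ x ∈ A, binaryChar h x = A.card - 2 * (A.filter (fun x => h ⬝ᵥ x ≠ 0)).card := by
  rw [Finset.card_filter, Finset.card_eq_sum_ones]
  push_cast
  rw [Finset.mul_sum, ← Finset.sum_sub_distrib]
  refine Finset.sum_congr rfl fun x _ => ?_
  unfold binaryChar
  split_ifs <;> simp_all

theorem eq_zero_of_forall_binaryChar_eq_one {x : ι → ZMod 2} (hx : ∀ h, binaryChar h x = 1) :
    x = 0 :=
  dotProduct_eq_zero x fun h => by
    rw [dotProduct_comm]; exact binaryChar_eq_one_iff.1 (hx h)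

variable [DecidableEq ι]

open Classical in
theorem sum_binaryChar_submodule (W : Submodule (ZMod 2) (ι → ZMod 2)) (h : ι → ZMod 2) :
    ∑ x with x ∈ W, binaryChar h x =
      if ∀ x ∈ W, h ⬝ᵥ x = 0 then (Nat.card W : ℤ) else 0 := by
  have hcard : Nat.card W = (Finset.univ.filter (· ∈ W)).card := by
    rw [Nat.card_eq_fintype_card]
    exact Fintype.card_subtype _
  split_ifs with hW
  · rw [Finset.sum_congr rfl (g := fun _ => (1 : ℤ))]
    · rw [Finset.sum_const, hcard, nsmul_eq_mul, mul_one]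
    · intro x hx
      exact binaryChar_eq_one_iff.2 (hW x (by simpa using hx))
  · push Not at hW
    obtain ⟨a, ha, hne⟩ := hW
    have hχ : binaryChar h a = -1 :=
      (binaryChar_eq_one_or h a).resolve_left (fun H => hne (binaryChar_eq_one_iff.1 H))
    -- translation by `a` permutes `W` and changes the sign of the character
    have key : ∑ x with x ∈ W, binaryChar h x = ∑ x with x ∈ W, -binaryChar h x := by
      refine Finset.sum_equiv (Equiv.addRight a) ?_ ?_
      · intro x
        simp [W.add_mem_iff_left ha]
      · intro x _
        simp [binaryChar_add_right, hχ]
    rw [Finset.sum_neg_distrib] at key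
    linarith

theorem sum_binaryChar_left (x : ι → ZMod 2) :
    ∑ h, binaryChar h x = if x = 0 then (Fintype.card (ι → ZMod 2) : ℤ) else 0 := by
  have H := sum_binaryChar_submodule (⊤ : Submodule (ZMod 2) (ι → ZMod 2)) x
  have hx : (∀ y ∈ (⊤ : Submodule (ZMod 2) (ι → ZMod 2)), x ⬝ᵥ y = 0) ↔ x = 0 := by
    simp [dotProduct_eq_zero_iff]
  simp only [hx] at H
  simpa [binaryChar_comm x] using H

theorem sum_sum_binaryChar {A : Finset (ι → ZMod 2)} (h0 : 0 ∉ A) :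
    ∑ h, ∑ x ∈ A, binaryChar h x = 0 := by
  rw [Finset.sum_comm]
  refine Finset.sum_eq_zero fun x hx => ?_
  rw [sum_binaryChar_left, if_neg (by rintro rfl; exact h0 hx)]

theorem sum_sq_sum_binaryChar (A : Finset (ι → ZMod 2)) :
    ∑ h, (∑ x ∈ A, binaryChar h x) ^ 2 = A.card * Fintype.card (ι → ZMod 2) := by
  classical
  simp_rw [sq, Finset.sum_mul_sum, ← binaryChar_add_right]
  rw [Finset.sum_comm]
  have : ∀ x ∈ A, ∑ h, ∑ y ∈ A, binaryChar h (x + y) = (Fintype.card (ι → ZMod 2) : ℤ) := by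
    intro x hx
    rw [Finset.sum_comm]
    simp_rw [sum_binaryChar_left, add_eq_zero_iff_eq_of_zmodTwo]
    rw [Finset.sum_ite_eq, if_pos hx]
  rw [Finset.sum_congr rfl this]
  simp

/-- Poisson summation for a product of weighted character sums. -/
theorem sum_prod_sum_binaryChar {κ : Type*} [Fintype κ] [DecidableEq κ]
    (t : κ → Finset (ι → ZMod 2)) (c : (ι → ZMod 2) → ℤ) :
    ∑ h, ∏ i, ∑ x ∈ t i, c x * binaryChar h x =
      Fintype.card (ι → ZMod 2) *
        ∑ y ∈ Fintype.piFinset t with ∑ i, y i = 0, ∏ i, c (y i) := by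
  simp_rw [Finset.prod_univ_sum, Finset.prod_mul_distrib, ← binaryChar_sum_right]
  rw [Finset.sum_comm, Finset.sum_filter, Finset.mul_sum]
  refine Finset.sum_congr rfl fun y _ => ?_
  rw [← Finset.mul_sum, sum_binaryChar_left]
  split_ifs <;> ring

end Characters

/-! ### Four disjoint lines in a 4-divisible set of 17 points -/

section FourLines

variable {ι : Type*} [Fintype ι] [DecidableEq ι]

/-- The linear dependencies between the elements of a family of subspaces: the families
`y` with `y i ∈ L i` for all `i` and `∑ i, y i = 0`. -/
def lineDependencies {κ : Type*} [Fintype κ] (L : κ → Submodule (ZMod 2) (ι → ZMod 2)) :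
    Submodule (ZMod 2) (κ → ι → ZMod 2) where
  carrier := {y | (∀ i, y i ∈ L i) ∧ ∑ i, y i = 0}
  add_mem' := by
    rintro a b ⟨ha, ha'⟩ ⟨hb, hb'⟩
    exact ⟨fun i => (L i).add_mem (ha i) (hb i), by simp [Finset.sum_add_distrib, ha', hb']⟩
  zero_mem' := ⟨fun i => (L i).zero_mem, by simp⟩
  smul_mem' := by
    rintro c a ⟨ha, ha'⟩
    exact ⟨fun i => (L i).smul_mem c (ha i), by simp [← Finset.smul_sum, ha']⟩

theorem card_submodule_zmodTwo {V : Type*} [AddCommGroup V] [Module (ZMod 2) V] [Finite V]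
    (W : Submodule (ZMod 2) V) : Nat.card W = 2 ^ Module.finrank (ZMod 2) W := by
  have := Fintype.ofFinite W
  rw [Nat.card_eq_fintype_card, Module.card_eq_pow_finrank (K := ZMod 2), ZMod.card]

open Classical in
theorem card_lineDependencies {κ : Type*} [Fintype κ] [DecidableEq κ]
    (L : κ → Submodule (ZMod 2) (ι → ZMod 2)) :
    Nat.card (lineDependencies L) =
      ((Fintype.piFinset fun i => Finset.univ.filter (· ∈ L i)).filter
        fun y => ∑ i, y i = 0).card := by
  rw [Nat.card_eq_fintype_card]
  refine Fintype.card_of_subtype _ fun y => ?_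
  simp [lineDependencies]

variable {L : Fin 4 → Submodule (ZMod 2) (ι → ZMod 2)}

open Classical in
theorem sum_binaryChar_line {W : Submodule (ZMod 2) (ι → ZMod 2)}
    (hW : Module.finrank (ZMod 2) W = 2) (h : ι → ZMod 2) :
    ∑ x with x ∈ W, binaryChar h x = if ∀ x ∈ W, h ⬝ᵥ x = 0 then 4 else 0 := by
  rw [sum_binaryChar_submodule, card_submodule_zmodTwo, hW]
  norm_num

open Classical in
/-- The number of linear forms vanishing on four lines, in terms of the linear dependencies
between the points of the lines. -/
theorem card_annihilator_lines (hL : ∀ i, Module.finrank (ZMod 2) (L i) = 2) :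
    256 * (Finset.univ.filter fun h : ι → ZMod 2 => ∀ i, ∀ x ∈ L i, h ⬝ᵥ x = 0).card =
      Fintype.card (ι → ZMod 2) * Nat.card (lineDependencies L) := by
  have key := sum_prod_sum_binaryChar (fun i => Finset.univ.filter (· ∈ L i)) fun _ => 1
  simp_rw [one_mul, sum_binaryChar_line (hL _)] at key
  have hprod : ∀ h : ι → ZMod 2, ∏ i, (if ∀ x ∈ L i, h ⬝ᵥ x = 0 then (4 : ℤ) else 0) =
      256 * if ∀ i, ∀ x ∈ L i, h ⬝ᵥ x = 0 then 1 else 0 := by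
    intro h
    split_ifs with H
    · rw [Finset.prod_congr rfl fun i _ => if_pos (H i)]
      norm_num
    · push Not at H
      obtain ⟨i, hi⟩ := H
      rw [Finset.prod_eq_zero (Finset.mem_univ i) (if_neg (by push Not; exact hi)), mul_zero]
  simp_rw [hprod] at key
  rw [← Finset.mul_sum, Finset.sum_boole, Finset.prod_const_one, Finset.sum_const,
    ← card_lineDependencies, nsmul_one] at key
  exact_mod_cast key

variable {Q : Finset (ι → ZMod 2)}

open Classical in
/-- The divisibility hypothesis says that the character sum over the four lines and `Q` together is
`1` modulo 8: the zero vector is counted four times in the sums over the lines. -/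
theorem sum_binaryChar_cases (hL : ∀ i, Module.finrank (ZMod 2) (L i) = 2) (hQ : Q.card = 5)
    (hdiv : ∀ h, (8 : ℤ) ∣
      ∑ x ∈ Q, binaryChar h x + ∑ i, ∑ x with x ∈ L i, binaryChar h x - 5) (h : ι → ZMod 2) :
    ∑ x ∈ Q, binaryChar h x = 5 ∨ ∑ x ∈ Q, binaryChar h x = 1 ∨
      ∑ x ∈ Q, binaryChar h x = -3 := by
  have h4 : (4 : ℤ) ∣ ∑ i, ∑ x with x ∈ L i, binaryChar h x :=
    Finset.dvd_sum fun i _ => by rw [sum_binaryChar_line (hL i)]; split_ifs <;> simp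
  have h8 := hdiv h
  have hle : (Q.filter (fun x => h ⬝ᵥ x ≠ 0)).card ≤ Q.card := Finset.card_filter_le _ _
  rw [sum_binaryChar_eq_card_sub, hQ] at h8 ⊢
  rw [hQ] at hle
  push_cast at *
  omega

open Classical in
/-- The parity of the number of lines on which a linear form does not vanish, expressed as a
quadratic polynomial in the character sum of the five remaining points. -/
theorem prod_sum_binaryChar_lines (hL : ∀ i, Module.finrank (ZMod 2) (L i) = 2)
    (hQ : Q.card = 5) (hdiv : ∀ h, (8 : ℤ) ∣
      ∑ x ∈ Q, binaryChar h x + ∑ i, ∑ x with x ∈ L i, binaryChar h x - 5) (h : ι → ZMod 2) :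
    ∏ i, (∑ x with x ∈ L i, binaryChar h x - 2) =
      2 * ((∑ x ∈ Q, binaryChar h x) ^ 2 - 2 * ∑ x ∈ Q, binaryChar h x - 7) := by
  have ht := sum_binaryChar_cases hL hQ hdiv h
  have h8 := hdiv h
  have hs : ∀ i, ∑ x with x ∈ L i, binaryChar h x = 0 ∨ ∑ x with x ∈ L i, binaryChar h x = 4 :=
    fun i => by rw [sum_binaryChar_line (hL i)]; split_ifs <;> simp
  rw [Fin.sum_univ_four] at h8
  rw [Fin.prod_univ_four]
  generalize ∑ x ∈ Q, binaryChar h x = t at *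
  rcases hs 0 with h0 | h0 <;> rcases hs 1 with h1 | h1 <;> rcases hs 2 with h2 | h2 <;>
    rcases hs 3 with h3 | h3 <;> rw [h0, h1, h2, h3] at h8 ⊢ <;>
    rcases ht with rfl | rfl | rfl <;> revert h8 <;> norm_num

open Classical in
/-- The four lines satisfy many linear dependencies, hence span a space of small dimension. -/
theorem eight_le_card_lineDependencies (hL : ∀ i, Module.finrank (ZMod 2) (L i) = 2)
    (hQ : Q.card = 5) (hQ0 : 0 ∉ Q) (hdiv : ∀ h, (8 : ℤ) ∣
      ∑ x ∈ Q, binaryChar h x + ∑ i, ∑ x with x ∈ L i, binaryChar h x - 5) :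
    8 ≤ Nat.card (lineDependencies L) := by
  set c : (ι → ZMod 2) → ℤ := fun x => if x = 0 then -1 else 1 with hc
  set D := (Fintype.piFinset fun i => Finset.univ.filter (· ∈ L i)).filter
        fun y => ∑ i, y i = 0 with hD
  have hcL : ∀ (i : Fin 4) (h : ι → ZMod 2), ∑ x with x ∈ L i, c x * binaryChar h x =
      ∑ x with x ∈ L i, binaryChar h x - 2 := by
    intro i h
    have : ∀ x, c x * binaryChar h x = binaryChar h x - if x = 0 then 2 else 0 := by
      intro x
      by_cases hx : x = 0
      · simp [hc, hx, binaryChar_zero_right]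
      · simp [hc, hx]
    simp_rw [this]
    rw [Finset.sum_sub_distrib, Finset.sum_ite_eq', if_pos (by simp)]
  have key := sum_prod_sum_binaryChar (fun i => Finset.univ.filter (· ∈ L i)) c
  simp_rw [hcL, prod_sum_binaryChar_lines hL hQ hdiv] at key
  rw [← Finset.mul_sum, Finset.sum_sub_distrib, Finset.sum_sub_distrib, ← Finset.mul_sum,
    sum_sum_binaryChar hQ0, sum_sq_sum_binaryChar, hQ, Finset.sum_const, Finset.card_univ,
    ← hD] at key
  have hV : (0 : ℤ) < Fintype.card (ι → ZMod 2) := by exact_mod_cast Fintype.card_pos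
  have hsum : ∑ y ∈ D, ∏ i, c (y i) = -4 := by
    apply mul_left_cancel₀ hV.ne'
    rw [← key]
    simp only [nsmul_eq_mul]
    push_cast
    ring
  -- the zero dependency contributes `2` to `∑ (1 + ∏ c)`, and no summand is negative
  have hge : (2 : ℤ) ≤ ∑ y ∈ D, (1 + ∏ i, c (y i)) := by
    have h0 : (0 : Fin 4 → ι → ZMod 2) ∈ D := by simp [hD]
    have h2 : (1 + ∏ i, c ((0 : Fin 4 → ι → ZMod 2) i)) = 2 := by simp [hc]
    rw [← h2]
    refine Finset.single_le_sum (f := fun y : Fin 4 → ι → ZMod 2 => 1 + ∏ i, c (y i))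
      (fun y _ => ?_) h0
    have habs : |∏ i, c (y i)| = 1 := by
      rw [Finset.abs_prod]
      refine Finset.prod_eq_one fun i _ => ?_
      simp only [hc]
      split_ifs <;> simp
    have := neg_abs_le (∏ i, c (y i))
    linarith
  rw [Finset.sum_add_distrib, hsum] at hge
  have h6 : 6 ≤ Nat.card (lineDependencies L) := by
    rw [card_lineDependencies, ← hD]
    simp only [Finset.sum_const, nsmul_eq_mul, mul_one] at hge
    omega
  rw [card_submodule_zmodTwo] at h6 ⊢
  generalize Module.finrank (ZMod 2) (lineDependencies L) = n at *
  have hn : 3 ≤ n := by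
    by_contra! hn
    interval_cases n <;> omega
  calc 8 = 2 ^ 3 := by norm_num
    _ ≤ 2 ^ n := Nat.pow_le_pow_right (by norm_num) hn

open Classical in
/-- A linear form vanishing on the four lines also vanishes on the five remaining points. Otherwise
it vanishes on exactly one of them, `q`, and every character takes the value `1` at this point:
`2 * binaryChar k q` is the sum of the character sums of `k` and of `h + k` over `Q`, which agree
modulo 8 and are `1` modulo 4. -/
theorem sum_binaryChar_eq_five (hL : ∀ i, Module.finrank (ZMod 2) (L i) = 2)
    (hQ : Q.card = 5) (hQ0 : 0 ∉ Q) (hdiv : ∀ h, (8 : ℤ) ∣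
      ∑ x ∈ Q, binaryChar h x + ∑ i, ∑ x with x ∈ L i, binaryChar h x - 5)
    {h : ι → ZMod 2} (hh : ∀ i, ∀ x ∈ L i, h ⬝ᵥ x = 0) :
    ∑ x ∈ Q, binaryChar h x = 5 := by
  have hs : ∑ i, ∑ x with x ∈ L i, binaryChar h x = 16 := by
    simp_rw [sum_binaryChar_line (hL _), if_pos (hh _)]
    norm_num
  have h8 := hdiv h
  rw [hs] at h8
  rcases sum_binaryChar_cases hL hQ hdiv h with ht | ht | ht
  · exact ht
  · rw [ht] at h8; omega
  exfalso
  have hcard : (Q.filter (fun x => h ⬝ᵥ x = 0)).card = 1 := by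
    have h1 := sum_binaryChar_eq_card_sub Q h
    have h2 := Finset.card_filter_add_card_filter_not (s := Q) (fun x => h ⬝ᵥ x = 0)
    simp only [← ne_eq] at h2
    omega
  obtain ⟨q, hq⟩ := Finset.card_eq_one.1 hcard
  have hqQ : q ∈ Q := by
    have : q ∈ Q.filter (fun x => h ⬝ᵥ x = 0) := by simp [hq]
    exact (Finset.mem_filter.1 this).1
  refine hQ0 ((eq_zero_of_forall_binaryChar_eq_one (x := q) fun k => ?_) ▸ hqQ)
  have hadd : ∑ x ∈ Q, binaryChar (h + k) x + ∑ x ∈ Q, binaryChar k x = 2 * binaryChar k q := by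
    rw [← Finset.sum_add_distrib, ← Finset.sum_singleton (fun x => binaryChar k x) q, ← hq,
      Finset.sum_filter, Finset.mul_sum]
    refine Finset.sum_congr rfl fun x _ => ?_
    rw [binaryChar_add_left]
    unfold binaryChar
    split_ifs <;> norm_num
  -- adding `h` changes none of the character sums over the lines
  have hlines : ∑ i, ∑ x with x ∈ L i, binaryChar (h + k) x =
      ∑ i, ∑ x with x ∈ L i, binaryChar k x := by
    refine Finset.sum_congr rfl fun i _ => Finset.sum_congr rfl fun x hx => ?_
    rw [binaryChar_add_left, binaryChar_eq_one_iff.2 (hh i x (by simpa using hx)), one_mul]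
  have hk := hdiv k
  have hhk := hdiv (h + k)
  rw [hlines] at hhk
  have htk := sum_binaryChar_cases hL hQ hdiv k
  rcases binaryChar_eq_one_or k q with H | H
  · exact H
  · omega

open Classical in
theorem false_of_four_lines {A : Finset (ι → ZMod 2)} (hA0 : 0 ∉ A) (hA : A.card = 17)
    (hdiv : ∀ h, 4 ∣ (A.filter (fun x => h ⬝ᵥ x ≠ 0)).card)
    (hL : ∀ i, Module.finrank (ZMod 2) (L i) = 2) (hLA : ∀ i, ∀ x ∈ L i, x ≠ 0 → x ∈ A)
    (hdisj : Pairwise fun i j => Disjoint (L i) (L j)) : False := by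
  set M : Fin 4 → Finset (ι → ZMod 2) := fun i => (Finset.univ.filter (· ∈ L i)).erase 0 with hM
  have hMdisj : ((Finset.univ : Finset (Fin 4)) : Set (Fin 4)).PairwiseDisjoint M := by
    intro i _ j _ hij
    refine Finset.disjoint_left.2 fun x hi hj => ?_
    simp only [hM, Finset.mem_erase, Finset.mem_filter, Finset.mem_univ, true_and] at hi hj
    exact hi.1 (Submodule.disjoint_def.1 (hdisj hij) x hi.2 hj.2)
  set B := Finset.univ.biUnion M with hB
  have hBA : B ⊆ A := by
    intro x hx
    simp only [hB, hM, Finset.mem_biUnion, Finset.mem_erase, Finset.mem_filter, Finset.mem_univ,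
      true_and] at hx
    obtain ⟨i, h0, hi⟩ := hx
    exact hLA i x hi h0
  have hsumM : ∀ i h, ∑ x ∈ M i, binaryChar h x = ∑ x with x ∈ L i, binaryChar h x - 1 := by
    intro i h
    have := Finset.sum_erase_add (Finset.univ.filter (· ∈ L i)) (fun x => binaryChar h x)
      (a := 0) (by simp)
    rw [binaryChar_zero_right] at this
    exact eq_sub_of_add_eq this
  have hMcard : ∀ i, (M i).card = 3 := by
    intro i
    have h0 := hsumM i 0
    rw [sum_binaryChar_line (hL i)] at h0
    have h3 : ((M i).card : ℤ) = 3 := by simpa [binaryChar] using h0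
    exact_mod_cast h3
  set Q := A \ B with hQdef
  have hQ : Q.card = 5 := by
    rw [hQdef, Finset.card_sdiff_of_subset hBA, hA, hB, Finset.card_biUnion hMdisj]
    simp [hMcard]
  have hQ0 : 0 ∉ Q := fun H => hA0 (Finset.sdiff_subset H)
  have hT : ∀ h, ∑ x ∈ A, binaryChar h x =
      ∑ x ∈ Q, binaryChar h x + ∑ i, ∑ x with x ∈ L i, binaryChar h x - 4 := by
    intro h
    rw [← Finset.sum_sdiff hBA, ← hQdef, hB, Finset.sum_biUnion hMdisj]
    simp_rw [hsumM]
    rw [Finset.sum_sub_distrib]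
    simp
    ring
  have hT8 : ∀ h, (8 : ℤ) ∣ ∑ x ∈ A, binaryChar h x - 1 := by
    intro h
    have := hdiv h
    rw [sum_binaryChar_eq_card_sub, hA]
    push_cast
    omega
  have hdivQ : ∀ h, (8 : ℤ) ∣
      ∑ x ∈ Q, binaryChar h x + ∑ i, ∑ x with x ∈ L i, binaryChar h x - 5 := by
    intro h
    have := hT8 h
    rw [hT] at this
    omega
  have hD := eight_le_card_lineDependencies hL hQ hQ0 hdivQ
  have hann := card_annihilator_lines hL
  set N := Finset.univ.filter fun h : ι → ZMod 2 => ∀ i, ∀ x ∈ L i, h ⬝ᵥ x = 0 with hN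
  have hV : 0 < Fintype.card (ι → ZMod 2) := Fintype.card_pos
  -- the quadratic `(T - 1) (T + 7)` is nonnegative at every value `T ≡ 1 (mod 8)`, and equals
  -- `16 * 24` at the value `T = 17` taken on `N`
  have hlow : (384 : ℤ) * N.card ≤
      ∑ h, (∑ x ∈ A, binaryChar h x - 1) * (∑ x ∈ A, binaryChar h x + 7) := by
    have hpt : ∀ h ∈ N, (384 : ℤ) ≤
        (∑ x ∈ A, binaryChar h x - 1) * (∑ x ∈ A, binaryChar h x + 7) := by
      intro h hh
      have hh' : ∀ i, ∀ x ∈ L i, h ⬝ᵥ x = 0 := by simpa [hN] using hh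
      have hs : ∑ i, ∑ x with x ∈ L i, binaryChar h x = 16 := by
        simp_rw [sum_binaryChar_line (hL _), if_pos (hh' _)]
        norm_num
      rw [hT, hs, sum_binaryChar_eq_five hL hQ hQ0 hdivQ hh']
      norm_num
    calc (384 : ℤ) * N.card = ∑ _h ∈ N, 384 := by simp [mul_comm]
      _ ≤ ∑ h ∈ N, (∑ x ∈ A, binaryChar h x - 1) * (∑ x ∈ A, binaryChar h x + 7) :=
        Finset.sum_le_sum hpt
      _ ≤ _ := by
        refine Finset.sum_le_sum_of_subset_of_nonneg (Finset.subset_univ _) fun h _ _ => ?_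
        obtain ⟨m, hm⟩ := hT8 h
        have hTm : ∑ x ∈ A, binaryChar h x = 8 * m + 1 := by linarith
        rw [hTm]
        rcases le_or_gt 0 m with h0 | h0 <;> nlinarith
  have hexp : ∑ h, (∑ x ∈ A, binaryChar h x - 1) * (∑ x ∈ A, binaryChar h x + 7) =
      10 * Fintype.card (ι → ZMod 2) := by
    have : ∀ h, (∑ x ∈ A, binaryChar h x - 1) * (∑ x ∈ A, binaryChar h x + 7) =
        (∑ x ∈ A, binaryChar h x) ^ 2 + 6 * ∑ x ∈ A, binaryChar h x - 7 := fun h => by ring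
    simp_rw [this]
    rw [Finset.sum_sub_distrib, Finset.sum_add_distrib, ← Finset.mul_sum, sum_sum_binaryChar hA0,
      sum_sq_sum_binaryChar, hA, Finset.sum_const, Finset.card_univ, nsmul_eq_mul]
    push_cast
    ring
  rw [hexp] at hlow
  have h1 : 384 * N.card ≤ 10 * Fintype.card (ι → ZMod 2) := by exact_mod_cast hlow
  nlinarith [Nat.mul_le_mul_left (Fintype.card (ι → ZMod 2)) hD]

end FourLines

/-! ### Points as nonzero vectors -/

section Points

variable {V : Type*} [AddCommGroup V] [Module (ZMod 2) V]

theorem rep_mk_zmodTwo (x : V) (hx : x ≠ 0) : (Projectivization.mk (ZMod 2) x hx).rep = x := by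
  obtain ⟨a, ha⟩ := Projectivization.exists_smul_eq_mk_rep (ZMod 2) x hx
  rw [← ha, Subsingleton.elim a 1, one_smul]

theorem rep_injective_zmodTwo :
    Function.Injective (Projectivization.rep : ℙ (ZMod 2) V → V) := by
  intro p q h
  rw [← p.mk_rep, ← q.mk_rep]
  congr

theorem projectivization_submodule_le_iff {p : ℙ (ZMod 2) V} {U : Submodule (ZMod 2) V} :
    p.submodule ≤ U ↔ p.rep ∈ U := by
  rw [Projectivization.submodule_eq, Submodule.span_singleton_le_iff_mem]

end Points

section LinesInDivisibleSets

variable {ι : Type*} [Fintype ι]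

open Classical in
theorem card_filter_dotProduct_of_isDivisiblePointSet {Δ : ℕ}
    {S : Set (ℙ (ZMod 2) (ι → ZMod 2))} (hS : IsDivisiblePointSet Δ S)
    {A : Finset (ι → ZMod 2)} (hA : (A : Set (ι → ZMod 2)) = Projectivization.rep '' S)
    (h : ι → ZMod 2) : Δ ∣ (A.filter (fun x => h ⬝ᵥ x ≠ 0)).card := by
  by_cases h0 : h = 0
  · simp [h0]
  have hf : (dotProductBilin (ZMod 2) (ZMod 2) h : (ι → ZMod 2) →ₗ[ZMod 2] ZMod 2) ≠ 0 := by
    intro H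
    exact h0 (dotProduct_eq_zero h fun w => LinearMap.congr_fun H w)
  have hdvd := hS (LinearMap.ker (dotProductBilin (ZMod 2) (ZMod 2) h))
    (Module.Dual.finrank_ker_add_one_of_ne_zero hf)
  rw [← Set.ncard_image_of_injective _ rep_injective_zmodTwo] at hdvd
  convert hdvd using 1
  rw [← Set.ncard_coe_finset]
  congr 1
  ext x
  have hx : x ∈ A ↔ x ∈ Projectivization.rep '' S := by rw [← hA, Finset.mem_coe]
  simp only [Finset.coe_filter, hx, Set.mem_ofPred_eq, Set.mem_image,
    projectivization_submodule_le_iff, LinearMap.mem_ker]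
  constructor
  · rintro ⟨⟨p, hp, rfl⟩, hne⟩
    exact ⟨p, ⟨hp, hne⟩, rfl⟩
  · rintro ⟨p, ⟨hp, hne⟩, rfl⟩
    exact ⟨⟨p, hp, rfl⟩, hne⟩

theorem card_disjoint_lines_le_three {S : Set (ℙ (ZMod 2) (ι → ZMod 2))}
    (hS : IsDivisiblePointSet 4 S) (hcard : S.ncard = 17)
    {L : Finset (Submodule (ZMod 2) (ι → ZMod 2))}
    (hL : ∀ l ∈ L, Module.finrank (ZMod 2) l = 2)
    (hLS : ∀ l ∈ L, ∀ p : ℙ (ZMod 2) (ι → ZMod 2), p.submodule ≤ l → p ∈ S)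
    (hdisj : (L : Set (Submodule (ZMod 2) (ι → ZMod 2))).Pairwise Disjoint) :
    L.card ≤ 3 := by
  classical
  by_contra! h4
  obtain ⟨L', hL'L, hL'⟩ := Finset.exists_subset_card_eq (s := L) (n := 4) h4
  let e := (Finset.equivFinOfCardEq hL').symm
  set A := (Set.toFinite (Projectivization.rep '' S)).toFinset with hA
  have hAS : (A : Set (ι → ZMod 2)) = Projectivization.rep '' S := Set.Finite.coe_toFinset _
  have hmem : ∀ x, x ∈ A ↔ x ∈ Projectivization.rep '' S := fun x => by
    rw [← hAS, Finset.mem_coe]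
  refine false_of_four_lines (A := A) (L := fun i => (e i : Submodule (ZMod 2) (ι → ZMod 2)))
    ?_ ?_ ?_ ?_ ?_ ?_
  · rw [hmem]
    rintro ⟨p, _, hp⟩
    exact p.rep_nonzero hp
  · rw [← Set.ncard_coe_finset, hAS, Set.ncard_image_of_injective _ rep_injective_zmodTwo, hcard]
  · intro h
    exact card_filter_dotProduct_of_isDivisiblePointSet hS hAS h
  · exact fun i => hL _ (hL'L (e i).2)
  · intro i x hx hx0
    rw [hmem]
    refine ⟨Projectivization.mk (ZMod 2) x hx0, hLS _ (hL'L (e i).2) _ ?_, rep_mk_zmodTwo x hx0⟩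
    rwa [projectivization_submodule_le_iff, rep_mk_zmodTwo]
  · intro i j hij
    exact hdisj (hL'L (e i).2) (hL'L (e j).2) fun H => hij (e.injective (Subtype.ext H))

end LinesInDivisibleSets

/-! ### Supertails of vector space partitions -/

section Supertails

variable {V : Type*} [AddCommGroup V] [Module (ZMod 2) V] {P : Set (Submodule (ZMod 2) V)}

theorem IsVectorSpacePartition.eq_of_mem (hP : IsVectorSpacePartition P)
    {U W : Submodule (ZMod 2) V} (hU : U ∈ P) (hW : W ∈ P) {x : V} (hx : x ≠ 0) (hxU : x ∈ U)
    (hxW : x ∈ W) : U = W := by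
  refine (hP.existsUnique_mem (Projectivization.mk (ZMod 2) x hx)).unique ⟨hU, ?_⟩ ⟨hW, ?_⟩ <;>
    rwa [projectivization_submodule_le_iff, rep_mk_zmodTwo]

theorem IsVectorSpacePartition.exists_mem (hP : IsVectorSpacePartition P) {x : V} (hx : x ≠ 0) :
    ∃ U ∈ P, x ∈ U := by
  obtain ⟨U, ⟨hU, hxU⟩, -⟩ := hP.existsUnique_mem (Projectivization.mk (ZMod 2) x hx)
  rw [projectivization_submodule_le_iff, rep_mk_zmodTwo] at hxU
  exact ⟨U, hU, hxU⟩

variable [Fintype V]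

open Classical in
theorem IsVectorSpacePartition.card_filter_eq_sum (hP : IsVectorSpacePartition P)
    {F : Finset (Submodule (ZMod 2) V)} (hF : ∀ U ∈ F, U ∈ P) (R : V → Prop) :
    (Finset.univ.filter fun x : V => x ≠ 0 ∧ R x ∧ ∃ U ∈ F, x ∈ U).card =
      ∑ U ∈ F, (Finset.univ.filter fun x : V => x ≠ 0 ∧ R x ∧ x ∈ U).card := by
  rw [← Finset.card_biUnion]
  · congr 1
    ext x
    simp only [Finset.mem_filter, Finset.mem_univ, true_and, Finset.mem_biUnion]
    tauto
  · intro U hU W hW hne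
    refine Finset.disjoint_left.2 fun x hxU hxW => hne ?_
    simp only [Finset.mem_filter, Finset.mem_univ, true_and] at hxU hxW
    exact hP.eq_of_mem (hF U hU) (hF W hW) hxU.1 hxU.2.2 hxW.2.2

open Classical in
theorem card_filter_nonzero (U : Submodule (ZMod 2) V) :
    (Finset.univ.filter fun x : V => x ≠ 0 ∧ True ∧ x ∈ U).card =
      2 ^ Module.finrank (ZMod 2) U - 1 := by
  rw [← card_submodule_zmodTwo, Nat.card_eq_fintype_card, Fintype.card_subtype,
    ← Finset.card_erase_of_mem (a := (0 : V)) (by simp)]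
  congr 1
  ext x
  simp

open Classical in
/-- A subspace of dimension at least three is 4-divisible. -/
theorem four_dvd_card_filter_notMem {H : Submodule (ZMod 2) V}
    (hH : Module.finrank (ZMod 2) H + 1 = Module.finrank (ZMod 2) V) (U : Submodule (ZMod 2) V)
    (hU : 2 < Module.finrank (ZMod 2) U) :
    4 ∣ (Finset.univ.filter fun x : V => x ≠ 0 ∧ x ∉ H ∧ x ∈ U).card := by
  have hset : (Finset.univ.filter fun x : V => x ≠ 0 ∧ x ∉ H ∧ x ∈ U) =
      (Finset.univ.filter (· ∈ U)) \ Finset.univ.filter (· ∈ U ⊓ H) := by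
    ext x
    simp only [Finset.mem_filter, Finset.mem_univ, true_and, Finset.mem_sdiff, Submodule.mem_inf]
    have : x = 0 → x ∈ H := fun h => h ▸ H.zero_mem
    tauto
  have hcard : ∀ W : Submodule (ZMod 2) V,
      (Finset.univ.filter (· ∈ W)).card = 2 ^ Module.finrank (ZMod 2) W := fun W => by
    rw [← card_submodule_zmodTwo, Nat.card_eq_fintype_card, Fintype.card_subtype]
  rw [hset, Finset.card_sdiff_of_subset, hcard, hcard]
  · have h1 := Submodule.finrank_sup_add_finrank_inf_eq U H
    have h2 := Submodule.finrank_le (U ⊔ H)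
    refine Nat.dvd_sub ?_ ?_ <;> exact pow_dvd_pow 2 (m := 2) (by omega)
  · intro x
    simp only [Finset.mem_filter, Finset.mem_univ, true_and, Submodule.mem_inf]
    tauto

/-- The points covered by the elements of `P` of dimension at most two. -/
def tailPoints (P : Set (Submodule (ZMod 2) V)) : Set (ℙ (ZMod 2) V) :=
  {p | ∃ U ∈ P, Module.finrank (ZMod 2) U ≤ 2 ∧ p.submodule ≤ U}

open Classical in
theorem IsVectorSpacePartition.ncard_tailPoints (hP : IsVectorSpacePartition P) (R : V → Prop) :
    {p ∈ tailPoints P | R p.rep}.ncard =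
      ∑ U with U ∈ P ∧ Module.finrank (ZMod 2) U ≤ 2,
        (Finset.univ.filter fun x : V => x ≠ 0 ∧ R x ∧ x ∈ U).card := by
  rw [← hP.card_filter_eq_sum (fun U hU => (Finset.mem_filter.1 hU).2.1),
    ← Set.ncard_image_of_injective _ rep_injective_zmodTwo, ← Set.ncard_coe_finset]
  congr 1
  ext x
  simp only [tailPoints, projectivization_submodule_le_iff, Set.mem_image, Set.mem_ofPred_eq,
    Finset.coe_filter, Finset.mem_filter, Finset.mem_univ, true_and]
  constructor
  · rintro ⟨p, ⟨⟨U, hU, hd, hp⟩, hR⟩, rfl⟩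
    exact ⟨p.rep_nonzero, hR, U, ⟨hU, hd⟩, hp⟩
  · rintro ⟨hx, hR, U, ⟨hU, hd⟩, hxU⟩
    refine ⟨Projectivization.mk (ZMod 2) x hx, ?_, rep_mk_zmodTwo x hx⟩
    rw [rep_mk_zmodTwo]
    exact ⟨⟨U, hU, hd, hxU⟩, hR⟩

theorem IsVectorSpacePartition.isDivisiblePointSet_tailPoints (hP : IsVectorSpacePartition P)
    (hV : 2 < Module.finrank (ZMod 2) V) : IsDivisiblePointSet 4 (tailPoints P) := by
  classical
  intro H hH
  simp only [projectivization_submodule_le_iff]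
  rw [hP.ncard_tailPoints (fun x => x ∉ H)]
  have htotal : 4 ∣ ∑ U with U ∈ P,
      (Finset.univ.filter fun x : V => x ≠ 0 ∧ x ∉ H ∧ x ∈ U).card := by
    have htop := four_dvd_card_filter_notMem hH ⊤ (by rwa [finrank_top])
    have hall := hP.card_filter_eq_sum (F := Finset.univ.filter (· ∈ P)) (by simp)
      (fun x => x ∉ H)
    convert htop using 1
    refine Eq.trans (by congr!) (hall.symm.trans (congrArg Finset.card (Finset.ext fun x => ?_)))
    simp only [Finset.mem_filter, Finset.mem_univ, true_and, Submodule.mem_top, and_true]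
    exact ⟨fun h => ⟨h.1, h.2.1⟩, fun h => ⟨h.1, h.2, hP.exists_mem h.1⟩⟩
  rw [← Finset.sum_filter_add_sum_filter_not _
      (fun U : Submodule (ZMod 2) V => Module.finrank (ZMod 2) U ≤ 2),
    Finset.filter_filter] at htotal
  have hlarge : 4 ∣ ∑ U ∈ (Finset.univ.filter (· ∈ P)).filter
      (fun U : Submodule (ZMod 2) V => ¬ Module.finrank (ZMod 2) U ≤ 2),
      (Finset.univ.filter fun x : V => x ≠ 0 ∧ x ∉ H ∧ x ∈ U).card := by
    refine Finset.dvd_sum fun U hU => ?_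
    convert four_dvd_card_filter_notMem hH U (not_le.1 (Finset.mem_filter.1 hU).2)
  convert (Nat.dvd_add_iff_left hlarge).2 htotal

theorem not_hasSupertail_two_one {ι : Type*} [Fintype ι]
    {P : Set (Submodule (ZMod 2) (ι → ZMod 2))} (hP : IsVectorSpacePartition P) :
    ¬ HasSupertail P ![2, 1] ![4, 5] := by
  classical
  intro hT
  obtain ⟨B, -, hB⟩ := hT.exists_lt
  have hV : 2 < Module.finrank (ZMod 2) (ι → ZMod 2) :=
    lt_of_lt_of_le hB (Submodule.finrank_le B)
  have hcount : ∀ (d n : ℕ), {U ∈ P | Module.finrank (ZMod 2) U = d}.encard = n →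
      (Finset.univ.filter fun U => U ∈ P ∧ Module.finrank (ZMod 2) U = d).card = n := by
    intro d n h
    have := Set.encard_coe_eq_coe_finsetCard
      (Finset.univ.filter fun U => U ∈ P ∧ Module.finrank (ZMod 2) U = d)
    rw [Finset.coe_filter_univ, h] at this
    exact_mod_cast this.symm
  have h2 := hcount 2 4 (hT.encard_eq 0)
  have h1 := hcount 1 5 (hT.encard_eq 1)
  have hdim : ∀ U ∈ P, (Module.finrank (ZMod 2) U ≤ 2 ↔
      Module.finrank (ZMod 2) U = 2 ∨ Module.finrank (ZMod 2) U = 1) := by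
    refine fun U hU => ⟨fun h => ?_, fun h => by omega⟩
    obtain ⟨j, hj⟩ := hT.dim_mem U hU h
    fin_cases j
    · exact Or.inl hj
    · exact Or.inr hj
  have hcard : (tailPoints P).ncard = 17 := by
    have h := hP.ncard_tailPoints (fun _ => True)
    rw [Finset.sum_congr rfl
        (g := fun U : Submodule (ZMod 2) (ι → ZMod 2) => 2 ^ Module.finrank (ZMod 2) U - 1)
      fun U _ => by convert card_filter_nonzero U] at h
    have hsplit : (Finset.univ.filter fun U => U ∈ P ∧ Module.finrank (ZMod 2) U ≤ 2) =
        (Finset.univ.filter fun U => U ∈ P ∧ Module.finrank (ZMod 2) U = 2) ∪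
          Finset.univ.filter fun U => U ∈ P ∧ Module.finrank (ZMod 2) U = 1 := by
      ext U
      simp only [Finset.mem_filter, Finset.mem_univ, true_and, Finset.mem_union]
      have := hdim U
      tauto
    rw [hsplit, Finset.sum_union, Finset.sum_congr rfl (g := fun _ => 3),
      Finset.sum_congr (s₁ := Finset.univ.filter fun U => U ∈ P ∧ Module.finrank (ZMod 2) U = 1)
        rfl (g := fun _ => 1), Finset.sum_const, Finset.sum_const, h1, h2] at h
    · simpa using h
    · intro U hU
      rw [(Finset.mem_filter.1 hU).2.2]
      norm_num
    · intro U hU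
      rw [(Finset.mem_filter.1 hU).2.2]
      norm_num
    · refine Finset.disjoint_left.2 fun U hU hU' => ?_
      have := (Finset.mem_filter.1 hU).2.2
      have := (Finset.mem_filter.1 hU').2.2
      omega
  have hle := card_disjoint_lines_le_three (hP.isDivisiblePointSet_tailPoints hV) hcard
    (L := Finset.univ.filter fun U => U ∈ P ∧ Module.finrank (ZMod 2) U = 2)
    (fun l hl => (Finset.mem_filter.1 hl).2.2)
    (fun l hl p hp => ⟨l, (Finset.mem_filter.1 hl).2.1, (Finset.mem_filter.1 hl).2.2.le, hp⟩)
    (by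
      intro U hU W hW hne
      refine Submodule.disjoint_def.2 fun x hxU hxW => ?_
      by_contra hx
      exact hne (hP.eq_of_mem (Finset.mem_filter.1 hU).2.1 (Finset.mem_filter.1 hW).2.1 hx
        hxU hxW))
  omega

end Supertails

theorem mainTheorem2 :
    (∀ (v : ℕ) (P : Set (Submodule (ZMod 2) (Fin v → ZMod 2))),
      IsVectorSpacePartition P → ¬ HasSupertail P ![2, 1] ![4, 5]) ∧
    (∀ (v : ℕ) (S : Set (ℙ (ZMod 2) (Fin v → ZMod 2))),
      IsDivisiblePointSet 4 S → S.ncard = 17 →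
      ∀ L : Finset (Submodule (ZMod 2) (Fin v → ZMod 2)),
        (∀ l ∈ L, Module.finrank (ZMod 2) l = 2) →
        (∀ l ∈ L, ∀ p : ℙ (ZMod 2) (Fin v → ZMod 2), p.submodule ≤ l → p ∈ S) →
        (L : Set (Submodule (ZMod 2) (Fin v → ZMod 2))).Pairwise Disjoint →
        L.card ≤ 3) ∧
    ¬ ∃ P : Set (Submodule (ZMod 2) (Fin 8 → ZMod 2)),
      IsVectorSpacePartition P ∧
        HasPartitionType P (Pi.single 3 34 + Pi.single 2 4 + Pi.single 1 5) := by
  refine ⟨fun v P hP => not_hasSupertail_two_one hP,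
    fun v S hS hcard L hL hLS hdisj => card_disjoint_lines_le_three hS hcard hL hLS hdisj, ?_⟩
  rintro ⟨P, hP, hT⟩
  refine not_hasSupertail_two_one hP ⟨?_, ?_, ?_, ?_, ?_⟩
  · intro i j hij
    fin_cases i <;> fin_cases j <;> simp_all
  · intro j
    fin_cases j <;> simp
  · intro j
    fin_cases j
    · simpa [Pi.single_apply] using hT 2
    · simpa [Pi.single_apply] using hT 1
  · have h3 := hT 3
    obtain ⟨U, hU, hd⟩ : {U ∈ P | Module.finrank (ZMod 2) U = 3}.Nonempty := by
      rw [← Set.encard_ne_zero, h3]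
      simp
    exact ⟨U, hU, by simp [hd]⟩
  · intro B hB hle
    have h0 : Module.finrank (ZMod 2) B ≠ 0 := fun H =>
      hP.bot_notMem (Submodule.finrank_eq_zero.1 H ▸ hB)
    have hle' : Module.finrank (ZMod 2) B ≤ 2 := hle
    have : Module.finrank (ZMod 2) B = 2 ∨ Module.finrank (ZMod 2) B = 1 := by omega
    rcases this with h | h
    · exact ⟨0, h⟩
    · exact ⟨1, h⟩
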